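/- All graphs are finite, simple and undirected, and $d$ is the distance between vertices. A packing $k$-coloring of a graph $G$ is a map $\Gamma:V(G)\to\{1,\dots,k\}$ such that any two distinct vertices of the same color $i$ are at distance at least $i+1$; the packing chromatic number $\chi_\rho(G)$ is the smallest $k$ for which $G$ has a packing $k$-coloring. A $(k,g)$-Moore graph is a $k$-regular graph of girth $g$ whose number of vertices is the Moore bound $n_0(k,g)$; for $g$ even, $n_0(k,g)=\frac{2(k-1)^{g/2}-2}{k-2}=2\sum_{i=0}^{g/2-1}(k-1)^i$ (so $n_0(q+1,8)=2(q+1)(q^2+1)$). For a finite field $F$ and a symbol $\rho\notin F$, let $Q_F$ be the bipartite graph with parts $V_0$ (points) and $V_1$ (lines), where $$V_i=\{(a,b,c)_i,\ (\rho,b,c)_i,\ (\rho,\rho,c)_i : a,b,c\in F\}\cup\{(\rho,\rho,\rho)_i\},$$ and with the following neighborhoods, for $a,b,c\in F$: $$N((a,b,c)_1)=\{(w,\,aw+b,\,a^2w+2ab+c)_0: w\in F\}\cup\{(\rho,a,c)_0\},$$ $$N((\rho,b,c)_1)=\{(c,b,w)_0: w\in F\}\cup\{(\rho,\rho,c)_0\},$$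 $$N((\rho,\rho,c)_1)=\{(\rho,c,w)_0: w\in F\}\cup\{(\rho,\rho,\rho)_0\},$$ $$N((\rho,\rho,\rho)_1)=\{(\rho,\rho,w)_0: w\in F\}\cup\{(\rho,\rho,\rho)_0\}.$$ **Theorem.** Let $q$ be an odd prime power and let $G$ be a $(q+1,8)$-Moore graph. Then $$(q^2+1)(q-1)+3\le\chi_\rho(G).$$ If moreover $G$ is isomorphic to the coordinatized incidence graph $Q_F$ for a field $F$ with $q$ elements, then also $$\chi_\rho(G)\le(q^2+1)(q-1)+4.$$ -/

import Mathlib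

/-- A packing `k`-coloring of `G`: a map `Γ : V → {1, …, k}` such that any two distinct vertices
of the same color `i` are at distance at least `i + 1`. The distance takes values in `ℕ∞`
and is `⊤` between different connected components. -/
def IsPackingColoring {V : Type*} (G : SimpleGraph V) (k : ℕ) (Γ : V → ℕ) : Prop :=
  (∀ v, 1 ≤ Γ v ∧ Γ v ≤ k) ∧
    ∀ u v, u ≠ v → Γ u = Γ v → ((Γ u + 1 : ℕ) : ℕ∞) ≤ G.edist u v

/-- The packing chromatic number: the smallest `k` for which `G` has a packing `k`-coloring. -/
noncomputable def packingChromaticNumber {V : Type*} (G : SimpleGraph V) : ℕ :=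
  sInf {k : ℕ | ∃ Γ : V → ℕ, IsPackingColoring G k Γ}

/-- On a finite graph the infimum is over a nonempty set, hence it is attained. -/
theorem exists_isPackingColoring_packingChromaticNumber {V : Type*} [Finite V]
    (G : SimpleGraph V) :
    ∃ Γ : V → ℕ, IsPackingColoring G (packingChromaticNumber G) Γ := by
  have h : {k : ℕ | ∃ Γ : V → ℕ, IsPackingColoring G k Γ}.Nonempty := by
    obtain ⟨n, ⟨e⟩⟩ := Finite.exists_equiv_fin V
    refine ⟨n, fun v => (e v : ℕ) + 1, fun v => ⟨Nat.succ_pos _, (e v).isLt⟩, ?_⟩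
    intro u v huv h
    exact absurd (e.injective (Fin.ext (by simpa using h))) huv
  exact Nat.sInf_mem h

/-- The Moore bound `n₀(k, g)`, the geometric sums being written out, so that `k = 2` needs
no special treatment. -/
def mooreBound (k g : ℕ) : ℕ :=
  if Even g then 2 * ∑ i ∈ Finset.range (g / 2), (k - 1) ^ i
  else 1 + k * ∑ i ∈ Finset.range ((g - 1) / 2), (k - 1) ^ i

/-- The closed form `n₀(k, g) = (2 (k - 1) ^ (g / 2) - 2) / (k - 2)` for even `g`, and
`n₀(k, g) = (k (k - 1) ^ ((g - 1) / 2) - 2) / (k - 2)` for odd `g`. -/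
theorem mooreBound_mul (k g : ℕ) (hk : 2 ≤ k) :
    (mooreBound k g : ℤ) * ((k : ℤ) - 2) =
      if Even g then 2 * ((k : ℤ) - 1) ^ (g / 2) - 2
      else (k : ℤ) * ((k : ℤ) - 1) ^ ((g - 1) / 2) - 2 := by
  have h1 : ((k - 1 : ℕ) : ℤ) = (k : ℤ) - 1 := by omega
  have geo (m : ℕ) := geom_sum_mul ((k : ℤ) - 1) m
  unfold mooreBound
  split_ifs with h
  · push_cast [h1]
    linear_combination 2 * geo (g / 2)
  · push_cast [h1]
    linear_combination (k : ℤ) * geo ((g - 1) / 2)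

/-- A `(k, g)`-Moore graph: a `k`-regular graph of girth `g` whose order is the Moore bound. -/
def IsMooreGraph {V : Type*} [Fintype V] (G : SimpleGraph V) [DecidableRel G.Adj]
    (k g : ℕ) : Prop :=
  G.IsRegularOfDegree k ∧ G.girth = g ∧ Fintype.card V = mooreBound k g

/-- The coordinates of a point or of a line of the quadrangle over `F`, with a symbol `ρ ∉ F`:
`aff a b c = (a, b, c)`, `rho₁ b c = (ρ, b, c)`, `rho₂ c = (ρ, ρ, c)`, `rho₃ = (ρ, ρ, ρ)`. -/
inductive GQCoord (F : Type*) where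
  | aff (a b c : F)
  | rho₁ (b c : F)
  | rho₂ (c : F)
  | rho₃

/-- `GQIncident x l`: the point with coordinates `x` lies on the line with coordinates `l`. -/
def GQIncident {F : Type*} [Field F] : GQCoord F → GQCoord F → Prop
  | .aff x y z, .aff a b c => y = a * x + b ∧ z = a ^ 2 * x + 2 * a * b + c
  | .rho₁ y z, .aff a _ c => y = a ∧ z = c
  | .aff x y _, .rho₁ b c => x = c ∧ y = b
  | .rho₂ z, .rho₁ _ c => z = c
  | .rho₁ y _, .rho₂ c => y = c
  | .rho₃, .rho₂ _ => True
  | .rho₂ _, .rho₃ => True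
  | .rho₃, .rho₃ => True
  | _, _ => False

/-- The incidence graph of the coordinatized generalized quadrangle over `F`: the vertices
`Sum.inl x` are the points, the vertices `Sum.inr l` are the lines. -/
def gqGraph (F : Type*) [Field F] : SimpleGraph (GQCoord F ⊕ GQCoord F) where
  Adj
    | .inl x, .inr l => GQIncident x l
    | .inr l, .inl x => GQIncident x l
    | _, _ => False
  symm := ⟨by rintro (x | x) (y | y) h <;> exact h⟩
  loopless := ⟨by rintro (x | x) h <;> exact h⟩

/-! Lower bound. In girth 8, adjacent vertices are joined by exactly `2q + 1` walks of length three
and non-adjacent ones by at most one. As `(q + 1)^3` such walks leave each vertex, the Moore bound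
forces `A^3 = 2qA + J'`, where `J'` marks the pairs on opposite sides of a bipartition: `G` is the
incidence graph of a generalized quadrangle of order `q` (`exists_isQuadrangle`). Its diameter is at
most 4, so each color above 3 occurs at most once. Color 3 lies on one side and has at most `q^2 +
1` vertices. The crux is `card_add_card_le`: colors 1 and 2 together cover at most `(q + 1)(q^2 + 1)
+ (q^2 + 1)` vertices, by incidence counting and the spectral gap. Out of `2(q + 1)(q^2 + 1)`
vertices, at least `(q^2 + 1)(q - 1)` remain for the `k - 3` other colors.

Upper bound. In `gqGraph F`, all lines take color 1, and two ovoids meeting in one point supply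
colors 2 and 3; every other point gets its own color. The shared point costs the one color that
separates the two bounds. -/

open Finset
open scoped Matrix

/-! ### Short closed walks and walks of length three in girth 8. -/

namespace SimpleGraph

variable {V : Type*} {G : SimpleGraph V}

theorem not_closed_walk_three (hg : 8 ≤ G.girth) {a b c : V}
    (h₁ : G.Adj a b) (h₂ : G.Adj b c) (h₃ : G.Adj c a) : False := by
  have hc : (Walk.cons h₁ (.cons h₂ (.cons h₃ .nil))).IsCycle := by
    simp [Walk.cons_isCycle_iff, h₁.ne, h₂.ne, h₃.ne, h₁.ne', h₃.ne']
  have := girth_le_length hc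
  simp at this
  omega

theorem not_cycle_four (hg : 8 ≤ G.girth) {a b c d : V}
    (h₁ : G.Adj a b) (h₂ : G.Adj b c) (h₃ : G.Adj c d) (h₄ : G.Adj d a)
    (hac : a ≠ c) (hbd : b ≠ d) : False := by
  have hc : (Walk.cons h₁ (.cons h₂ (.cons h₃ (.cons h₄ .nil)))).IsCycle := by
    simp [Walk.cons_isCycle_iff, h₁.ne, h₂.ne, h₃.ne, h₄.ne, h₁.ne', h₄.ne',
      hac, hbd, hac.symm]
  have := girth_le_length hc
  simp at this
  omega

theorem not_closed_walk_five (hg : 8 ≤ G.girth) {a b c d e : V}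
    (h₁ : G.Adj a b) (h₂ : G.Adj b c) (h₃ : G.Adj c d) (h₄ : G.Adj d e) (h₅ : G.Adj e a) :
    False := by
  have hac : a ≠ c := by rintro rfl; exact not_closed_walk_three hg h₃ h₄ h₅
  have hbd : b ≠ d := by rintro rfl; exact not_closed_walk_three hg h₄ h₅ h₁
  have hce : c ≠ e := by rintro rfl; exact not_closed_walk_three hg h₅ h₁ h₂
  have hda : d ≠ a := by rintro rfl; exact not_closed_walk_three hg h₁ h₂ h₃
  have heb : e ≠ b := by rintro rfl; exact not_closed_walk_three hg h₂ h₃ h₄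
  have hc : (Walk.cons h₁ (.cons h₂ (.cons h₃ (.cons h₄ (.cons h₅ .nil))))).IsCycle := by
    simp [Walk.cons_isCycle_iff, h₁.ne, h₂.ne, h₃.ne, h₄.ne, h₅.ne, h₁.ne',
      h₅.ne', hac, hbd, hce, hda, hac.symm, hda.symm, heb.symm]
  have := girth_le_length hc
  simp at this
  omega

theorem not_cycle_six (hg : 8 ≤ G.girth) {a b c d e f : V}
    (h₁ : G.Adj a b) (h₂ : G.Adj b c) (h₃ : G.Adj c d) (h₄ : G.Adj d e) (h₅ : G.Adj e f)
    (h₆ : G.Adj f a) (hac : a ≠ c) (hbd : b ≠ d) (hce : c ≠ e) (hdf : d ≠ f) (hea : e ≠ a)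
    (hfb : f ≠ b) : False := by
  have had : a ≠ d := by rintro rfl; exact not_closed_walk_three hg h₁ h₂ h₃
  have hbe : b ≠ e := by rintro rfl; exact not_closed_walk_three hg h₂ h₃ h₄
  have hcf : c ≠ f := by rintro rfl; exact not_closed_walk_three hg h₃ h₄ h₅
  have hc : (Walk.cons h₁ (.cons h₂ (.cons h₃ (.cons h₄ (.cons h₅ (.cons h₆ .nil)))))).IsCycle := by
    simp [Walk.cons_isCycle_iff, h₁.ne, h₂.ne, h₃.ne, h₄.ne, h₅.ne, h₆.ne, h₁.ne',
      h₆.ne', hac, hbd, hce, hdf, hea, hac.symm,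
      hea.symm, hfb.symm, had, hbe, hcf, had.symm]
  have := girth_le_length hc
  simp at this
  omega

/-- No distinctness is needed for odd lengths: a repeated vertex would split off a shorter odd
closed walk. -/
theorem not_closed_walk_seven (hg : 8 ≤ G.girth) {a b c d e f g : V}
    (h₁ : G.Adj a b) (h₂ : G.Adj b c) (h₃ : G.Adj c d) (h₄ : G.Adj d e) (h₅ : G.Adj e f)
    (h₆ : G.Adj f g) (h₇ : G.Adj g a) : False := by
  have hac : a ≠ c := by rintro rfl; exact not_closed_walk_five hg h₃ h₄ h₅ h₆ h₇
  have hbd : b ≠ d := by rintro rfl; exact not_closed_walk_five hg h₄ h₅ h₆ h₇ h₁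
  have hce : c ≠ e := by rintro rfl; exact not_closed_walk_five hg h₅ h₆ h₇ h₁ h₂
  have hdf : d ≠ f := by rintro rfl; exact not_closed_walk_five hg h₆ h₇ h₁ h₂ h₃
  have heg : e ≠ g := by rintro rfl; exact not_closed_walk_five hg h₇ h₁ h₂ h₃ h₄
  have hfa : f ≠ a := by rintro rfl; exact not_closed_walk_five hg h₁ h₂ h₃ h₄ h₅
  have hgb : g ≠ b := by rintro rfl; exact not_closed_walk_five hg h₂ h₃ h₄ h₅ h₆
  have had : a ≠ d := by rintro rfl; exact not_closed_walk_three hg h₁ h₂ h₃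
  have hbe : b ≠ e := by rintro rfl; exact not_closed_walk_three hg h₂ h₃ h₄
  have hcf : c ≠ f := by rintro rfl; exact not_closed_walk_three hg h₃ h₄ h₅
  have hdg : d ≠ g := by rintro rfl; exact not_closed_walk_three hg h₄ h₅ h₆
  have hea : e ≠ a := by rintro rfl; exact not_closed_walk_three hg h₅ h₆ h₇
  have hfb : f ≠ b := by rintro rfl; exact not_closed_walk_three hg h₆ h₇ h₁
  have hgc : g ≠ c := by rintro rfl; exact not_closed_walk_three hg h₇ h₁ h₂
  have hc : (Walk.cons h₁ (.cons h₂ (.cons h₃ (.cons h₄ (.cons h₅ (.cons h₆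
      (.cons h₇ .nil))))))).IsCycle := by
    simp [Walk.cons_isCycle_iff, h₁.ne, h₂.ne, h₃.ne, h₄.ne, h₅.ne, h₆.ne, h₇.ne, h₁.ne',
      h₇.ne', hac, hbd, hce, hdf, heg, hfa, hac.symm,
      hfa.symm, hgb.symm, had, hbe, hcf, hdg, hea,
      had.symm, hea.symm, hfb.symm, hgc.symm]
  have := girth_le_length hc
  simp at this
  omega

variable [Fintype V] [DecidableRel G.Adj]

variable (G) in
/-- The interior vertices of the walks of length three from `u` to `w`. -/
def threeWalks (u w : V) : Finset (V × V) :=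
  univ.filter fun p => G.Adj u p.1 ∧ G.Adj p.1 p.2 ∧ G.Adj p.2 w

theorem mem_threeWalks {u w : V} {p : V × V} :
    p ∈ G.threeWalks u w ↔ G.Adj u p.1 ∧ G.Adj p.1 p.2 ∧ G.Adj p.2 w := by
  simp [threeWalks]

variable [DecidableEq V]

/-- Without 4-cycles such a walk must backtrack, as `u a u w` or `u w b w`; the walk `u w u w` has
both forms. -/
theorem card_threeWalks_of_adj (hg : 8 ≤ G.girth) {k : ℕ} (hk : G.IsRegularOfDegree k)
    {u w : V} (h : G.Adj u w) : #(G.threeWalks u w) + 1 = 2 * k := by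
  have hset : G.threeWalks u w = (G.neighborFinset u).image (fun a => (a, u)) ∪
      (G.neighborFinset w).image (fun b => (w, b)) := by
    ext ⟨a, b⟩
    simp only [mem_threeWalks, mem_union, mem_image, mem_neighborFinset, Prod.mk.injEq]
    constructor
    · rintro ⟨h₁, h₂, h₃⟩
      by_cases hb : u = b
      · exact .inl ⟨a, h₁, rfl, hb⟩
      · by_cases ha : a = w
        · exact .inr ⟨b, h₃.symm, ha.symm, rfl⟩
        · exact (not_cycle_four hg h₁ h₂ h₃ h.symm hb ha).elim
    · rintro (⟨a', h', rfl, rfl⟩ | ⟨b', h', rfl, rfl⟩)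
      · exact ⟨h', h'.symm, h⟩
      · exact ⟨h, h', h'.symm⟩
  have hint : (G.neighborFinset u).image (fun a => (a, u)) ∩
      (G.neighborFinset w).image (fun b => (w, b)) = {(w, u)} := by
    ext ⟨a, b⟩
    simp only [mem_inter, mem_image, mem_neighborFinset, Prod.mk.injEq, mem_singleton]
    constructor
    · rintro ⟨⟨_, _, rfl, rfl⟩, ⟨_, _, rfl, rfl⟩⟩
      exact ⟨rfl, rfl⟩
    · rintro ⟨rfl, rfl⟩
      exact ⟨⟨a, h, rfl, rfl⟩, ⟨b, h.symm, rfl, rfl⟩⟩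
  have := card_union_add_card_inter ((G.neighborFinset u).image (fun a => (a, u)))
    ((G.neighborFinset w).image (fun b => (w, b)))
  rw [← hset, hint, card_image_of_injective _ (fun a b h => by simpa using h),
    card_image_of_injective _ (fun a b h => by simpa using h), card_neighborFinset_eq_degree,
    card_neighborFinset_eq_degree, hk u, hk w, card_singleton] at this
  omega

theorem card_threeWalks_le_one (hg : 8 ≤ G.girth) {u w : V} (h : ¬ G.Adj u w) :
    #(G.threeWalks u w) ≤ 1 := by
  rw [card_le_one]
  rintro ⟨a, b⟩ hp ⟨a', b'⟩ hp'
  rw [mem_threeWalks] at hp hp'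
  obtain ⟨h₁, h₂, h₃⟩ := hp
  obtain ⟨h₁', h₂', h₃'⟩ := hp'
  dsimp only at *
  have haw : a ≠ w := by rintro rfl; exact h h₁
  have haw' : a' ≠ w := by rintro rfl; exact h h₁'
  have hub : u ≠ b := by rintro rfl; exact h h₃
  have hub' : u ≠ b' := by rintro rfl; exact h h₃'
  by_cases haa : a = a'
  · subst haa
    by_cases hbb : b = b'
    · rw [hbb]
    · exact (not_cycle_four hg h₂ h₃ h₃'.symm h₂'.symm haw hbb).elim
  · by_cases hbb : b = b'
    · subst hbb
      exact (not_cycle_four hg h₁ h₂ h₂'.symm h₁'.symm hub haa).elim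
    · exact (not_cycle_six hg h₁ h₂ h₃ h₃'.symm h₂'.symm h₁'.symm hub haw hbb haw'.symm
        hub'.symm (Ne.symm haa)).elim

theorem adjMatrix_pow_three_apply (u w : V) :
    (G.adjMatrix ℤ ^ 3) u w = #(G.threeWalks u w) := by
  rw [pow_succ, pow_two, Matrix.mul_apply]
  simp_rw [Matrix.mul_apply, adjMatrix_apply, sum_mul, threeWalks, card_filter]
  rw [Fintype.sum_prod_type, sum_comm]
  push_cast
  refine sum_congr rfl fun a _ => sum_congr rfl fun b _ => ?_
  split_ifs <;> simp_all

theorem sum_adjMatrix_pow_three {k : ℕ} (hk : G.IsRegularOfDegree k) (u : V) :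
    ∑ w, (G.adjMatrix ℤ ^ 3) u w = k ^ 3 := by
  have h : G.adjMatrix ℤ ^ 3 *ᵥ Function.const V 1 = Function.const V ((k : ℤ) ^ 3) := by
    have h1 (a : ℤ) : G.adjMatrix ℤ *ᵥ Function.const V a = Function.const V (k * a) :=
      funext fun v => by
        rw [adjMatrix_mulVec_const_apply_of_regular hk, Function.const_apply]
    rw [pow_succ, pow_two, ← Matrix.mulVec_mulVec, ← Matrix.mulVec_mulVec, h1, h1, h1]
    congr 1
    ring
  simpa [Matrix.mulVec, dotProduct] using congrFun h u

end SimpleGraph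

/-! ### From Moore graphs to generalized quadrangles. -/

namespace SimpleGraph

variable {V : Type*} {G : SimpleGraph V} [Fintype V] [DecidableEq V] [DecidableRel G.Adj]

/-- The `k * #s` edges leaving the independent set `s` already exhaust all degrees in `sᶜ`, so no
edge lies inside `sᶜ`. -/
theorem mem_of_adj_of_notMem_of_card {k : ℕ} (hk : G.IsRegularOfDegree k) {s : Finset V}
    (hs : ∀ u ∈ s, ∀ v ∈ s, ¬ G.Adj u v) (hcard : #s = #sᶜ) {u v : V} (h : G.Adj u v)
    (hu : u ∉ s) : v ∈ s := by
  have hdc := sum_card_bipartiteAbove_eq_sum_card_bipartiteBelow (s := s) (t := sᶜ) G.Adj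
  have h1 : ∀ a ∈ s, #(bipartiteAbove G.Adj sᶜ a) = k := fun a ha => by
    rw [← hk a, ← card_neighborFinset_eq_degree]
    congr 1
    ext b
    simp only [mem_bipartiteAbove, mem_compl, mem_neighborFinset, and_iff_right_iff_imp]
    exact fun hab hb => hs a ha b hb hab
  have hsub (b : V) : bipartiteBelow G.Adj s b ⊆ G.neighborFinset b := fun a ha => by
    rw [mem_bipartiteBelow] at ha
    exact (mem_neighborFinset ..).2 ha.2.symm
  have h2 : ∀ b ∈ sᶜ, #(bipartiteBelow G.Adj s b) ≤ k := fun b _ => by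
    rw [← hk b, ← card_neighborFinset_eq_degree]
    exact card_le_card (hsub b)
  rw [sum_congr rfl h1, sum_const, hcard, ← sum_const] at hdc
  have h3 := (sum_eq_sum_iff_of_le h2).1 hdc.symm u (mem_compl.2 hu)
  have h4 : bipartiteBelow G.Adj s u = G.neighborFinset u :=
    eq_of_subset_of_card_le (hsub u) (by rw [h3, card_neighborFinset_eq_degree, hk u])
  have h5 : v ∈ bipartiteBelow G.Adj s u := h4 ▸ (mem_neighborFinset ..).2 h
  exact (mem_bipartiteBelow ..|>.1 h5).1

variable (G) in
/-- The vertices that end a walk of length three from `u`. -/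
def oddSphere (u : V) : Finset V := univ.filter fun w => (G.threeWalks u w).Nonempty

omit [DecidableEq V] in
theorem mem_oddSphere {u w : V} :
    w ∈ G.oddSphere u ↔ ∃ a b, G.Adj u a ∧ G.Adj a b ∧ G.Adj b w := by
  simp [oddSphere, Finset.Nonempty, mem_threeWalks]

theorem adjMatrix_pow_three_apply_eq_add (hg : 8 ≤ G.girth) {q : ℕ}
    (hk : G.IsRegularOfDegree (q + 1)) (u w : V) : (G.adjMatrix ℤ ^ 3) u w =
      2 * q * G.adjMatrix ℤ u w + if w ∈ G.oddSphere u then 1 else 0 := by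
  rw [adjMatrix_pow_three_apply, adjMatrix_apply]
  simp only [oddSphere, mem_filter, mem_univ, true_and]
  split_ifs with h1 h2 h2
  · have := card_threeWalks_of_adj hg hk h1
    push_cast [show #(G.threeWalks u w) = 2 * q + 1 by omega]
    ring
  · have := card_threeWalks_of_adj hg hk h1
    rw [not_nonempty_iff_eq_empty] at h2
    simp [h2] at this
    omega
  · have := card_threeWalks_le_one hg h1
    rw [show #(G.threeWalks u w) = 1 from le_antisymm this h2.card_pos]
    simp
  · rw [not_nonempty_iff_eq_empty] at h2
    simp [h2]

theorem card_oddSphere (hg : 8 ≤ G.girth) {q : ℕ} (hk : G.IsRegularOfDegree (q + 1)) (u : V) :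
    #(G.oddSphere u) = (q + 1) * (q ^ 2 + 1) := by
  have h := sum_adjMatrix_pow_three hk u
  simp_rw [adjMatrix_pow_three_apply_eq_add hg hk, sum_add_distrib, ← mul_sum, sum_boole] at h
  have h1 : ∑ w, G.adjMatrix ℤ u w = q + 1 := by
    simp [adjMatrix_apply, ← neighborFinset_eq_filter, hk u]
  rw [h1] at h
  simp only [filter_univ_mem] at h
  zify
  push_cast at h
  linear_combination h

/-- The structure of a generalized quadrangle of order `q` on the incidence graph `G`, whose
points are the vertices in `P`. -/
structure IsQuadrangle (G : SimpleGraph V) [DecidableRel G.Adj] (q : ℕ) (P : Finset V) :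
    Prop where
  regular : G.IsRegularOfDegree (q + 1)
  card : #P = (q + 1) * (q ^ 2 + 1)
  card_compl : #Pᶜ = (q + 1) * (q ^ 2 + 1)
  mem_iff : ∀ {u v}, G.Adj u v → (u ∈ P ↔ v ∉ P)
  pow_three : ∀ u w, (G.adjMatrix ℤ ^ 3) u w =
    2 * q * G.adjMatrix ℤ u w + if (u ∈ P ↔ w ∈ P) then 0 else 1

theorem exists_isQuadrangle (q : ℕ) (hG : IsMooreGraph G (q + 1) 8) :
    ∃ P, G.IsQuadrangle q P := by
  obtain ⟨hk, hg, hn⟩ := hG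
  replace hg := hg.ge
  have hn : Fintype.card V = 2 * ((q + 1) * (q ^ 2 + 1)) := by
    rw [hn]
    simp [mooreBound, sum_range_succ, show Even 8 by decide]
    ring
  have hcard := card_oddSphere hg hk
  have hcompl (u : V) : #(G.oddSphere u)ᶜ = (q + 1) * (q ^ 2 + 1) := by
    rw [card_compl, hcard u, hn]
    omega
  have : Nonempty V := Fintype.card_pos_iff.1 (by rw [hn]; positivity)
  obtain ⟨u₀⟩ := this
  -- An edge inside the odd sphere would close a walk of length 3 + 1 + 3.
  have hind : ∀ u ∈ G.oddSphere u₀, ∀ v ∈ G.oddSphere u₀, ¬ G.Adj u v := by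
    intro u hu v hv huv
    obtain ⟨a, b, h₁, h₂, h₃⟩ := mem_oddSphere.1 hu
    obtain ⟨c, d, h₄, h₅, h₆⟩ := mem_oddSphere.1 hv
    exact not_closed_walk_seven hg h₁ h₂ h₃ huv h₆.symm h₅.symm h₄.symm
  have hmem {u v : V} (h : G.Adj u v) : u ∈ G.oddSphere u₀ ↔ v ∉ G.oddSphere u₀ :=
    ⟨fun hu hv => hind u hu v hv h, fun hv =>
      mem_of_adj_of_notMem_of_card hk hind ((hcard u₀).trans (hcompl u₀).symm) h.symm hv⟩
  refine ⟨G.oddSphere u₀, hk, hcard u₀, hcompl u₀, hmem, fun u w => ?_⟩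
  have hflip {w : V} (hw : w ∈ G.oddSphere u) :
      ¬ (u ∈ G.oddSphere u₀ ↔ w ∈ G.oddSphere u₀) := by
    obtain ⟨a, b, h₁, h₂, h₃⟩ := mem_oddSphere.1 hw
    rw [hmem h₁, hmem h₂, hmem h₃]
    tauto
  -- By parity every odd sphere lies in the side opposite its center; the cardinalities agree, so it
  -- fills that side.
  have hiff : w ∈ G.oddSphere u ↔ ¬ (u ∈ G.oddSphere u₀ ↔ w ∈ G.oddSphere u₀) := by
    refine ⟨hflip, fun h => ?_⟩
    by_cases hu : u ∈ G.oddSphere u₀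
    · have hsub : G.oddSphere u ⊆ (G.oddSphere u₀)ᶜ := fun x hx => by
        have := hflip hx
        rw [mem_compl]
        tauto
      rw [eq_of_subset_of_card_le hsub (by rw [hcard, hcompl]), mem_compl]
      tauto
    · have hsub : G.oddSphere u ⊆ G.oddSphere u₀ := fun x hx => by
        have := hflip hx
        tauto
      rw [eq_of_subset_of_card_le hsub (by rw [hcard, hcard])]
      tauto
  rw [adjMatrix_pow_three_apply_eq_add hg hk]
  congr 1
  simp only [hiff]
  split_ifs <;> simp_all

/-- Point-line duality, so that each later argument is needed for one side only. -/
theorem IsQuadrangle.compl {q : ℕ} {P : Finset V} (h : G.IsQuadrangle q P) :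
    G.IsQuadrangle q Pᶜ where
  regular := h.regular
  card := h.card_compl
  card_compl := by rw [compl_compl, h.card]
  mem_iff := fun {u v} huv => by
    rw [mem_compl, mem_compl, not_not]
    have := h.mem_iff huv
    tauto
  pow_three u w := by
    rw [h.pow_three]
    simp only [mem_compl, not_iff_not]

end SimpleGraph

/-! ### Spectral and counting bounds in a quadrangle. -/

namespace SimpleGraph

variable {V : Type*} {G : SimpleGraph V} [Fintype V] [DecidableEq V] [DecidableRel G.Adj]
  {q : ℕ} {P : Finset V}

theorem adjMatrix_mulVec_indicator (s : Finset V) (v : V) :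
    (G.adjMatrix ℤ *ᵥ fun w => if w ∈ s then 1 else 0) v = #(G.neighborFinset v ∩ s) := by
  rw [adjMatrix_mulVec_apply, sum_boole]
  congr 2

omit [DecidableEq V] in
theorem dotProduct_adjMatrix_mulVec_comm (x y : V → ℤ) :
    x ⬝ᵥ (G.adjMatrix ℤ *ᵥ y) = (G.adjMatrix ℤ *ᵥ x) ⬝ᵥ y := by
  rw [Matrix.dotProduct_mulVec, ← Matrix.mulVec_transpose, transpose_adjMatrix]

namespace IsQuadrangle

theorem card_neighborFinset_inter (h : G.IsQuadrangle q P) (v : V) :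
    #(G.neighborFinset v ∩ P) = if v ∈ P then 0 else q + 1 := by
  split_ifs with hv
  · rw [card_eq_zero, ← disjoint_iff_inter_eq_empty, Finset.disjoint_left]
    exact fun w hw => (h.mem_iff ((mem_neighborFinset ..).1 hw)).1 hv
  · rw [inter_eq_left.2, card_neighborFinset_eq_degree, h.regular v]
    intro w hw
    have := h.mem_iff ((mem_neighborFinset ..).1 hw)
    tauto

/-- The spectral gap of the point-line incidence relation, as a bound on the second moment of the
number of neighbors in a set of lines. -/
theorem sum_sq_card_neighborFinset_inter_le (h : G.IsQuadrangle q P) (hq : 0 < q) {T : Finset V}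
    (hT : T ⊆ Pᶜ) :
    ((q : ℤ) + 1) * ∑ v, (#(G.neighborFinset v ∩ T) : ℤ) ^ 2 ≤
      2 * q * (q + 1) * #T + (#T : ℤ) ^ 2 := by
  set A := G.adjMatrix ℤ with hA
  set x : V → ℤ := fun w => if w ∈ T then 1 else 0 with hx
  set i : V → ℤ := fun w => if w ∈ P then 1 else 0 with hi
  set j : V → ℤ := fun w => if w ∈ Pᶜ then 1 else 0 with hj
  set f := A *ᵥ x with hf
  set y := A *ᵥ f with hy
  set t : ℤ := (#T : ℤ) with ht
  have hAi : A *ᵥ i = ((q : ℤ) + 1) • j := by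
    ext v
    rw [hi, hA, adjMatrix_mulVec_indicator, h.card_neighborFinset_inter]
    by_cases hv : v ∈ P <;> simp [hj, hv]
  have hAj : A *ᵥ j = ((q : ℤ) + 1) • i := by
    ext v
    rw [hj, hA, adjMatrix_mulVec_indicator, h.compl.card_neighborFinset_inter]
    by_cases hv : v ∈ P <;> simp [hi, hv]
  have hxj : x ⬝ᵥ j = t := by
    have : ∀ v, x v * j v = if v ∈ T then 1 else 0 := fun v => by
      by_cases hv : v ∈ T
      · simp [hx, hj, hv, mem_compl.1 (hT hv)]
      · simp [hx, hv]
    simp [dotProduct, this, ht]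
  have hxx : x ⬝ᵥ x = t := by simp [dotProduct, hx, ht]
  have hjj : j ⬝ᵥ j = (q + 1) * (q ^ 2 + 1) := by
    have := h.card_compl
    zify at this
    rw [← this]
    have : ∀ v, j v * j v = if v ∈ Pᶜ then 1 else 0 := fun v => by
      by_cases hv : v ∈ P <;> simp [hj, hv]
    simp only [dotProduct, this, sum_boole, filter_univ_mem]
  have hAy : A *ᵥ y = (2 * (q : ℤ)) • f + t • i := by
    have h3 : A *ᵥ y = A ^ 3 *ᵥ x := by
      rw [hy, hf, Matrix.mulVec_mulVec, Matrix.mulVec_mulVec, pow_succ, pow_two]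
    rw [h3]
    ext u
    simp only [Matrix.mulVec, dotProduct, hA, h.pow_three, add_mul, sum_add_distrib,
      Pi.add_apply, Pi.smul_apply, smul_eq_mul, hf, mul_sum, mul_assoc]
    congr 1
    rw [ht, card_eq_sum_ones]
    push_cast
    rw [sum_mul, ← sum_filter_add_sum_filter_not univ (· ∈ T)]
    have e1 : ∑ w with w ∉ T, (if (u ∈ P ↔ w ∈ P) then 0 else 1) * x w = 0 :=
      sum_eq_zero fun w hw => by simp [hx, (mem_filter.1 hw).2]
    rw [e1, add_zero, filter_univ_mem]
    refine sum_congr rfl fun w hw => ?_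
    have := mem_compl.1 (hT hw)
    by_cases hu : u ∈ P <;> simp [hx, hi, hw, this, hu]
  have hif : i ⬝ᵥ f = (q + 1) * t := by
    rw [hf, hA, dotProduct_adjMatrix_mulVec_comm, ← hA, hAi, smul_dotProduct, dotProduct_comm, hxj,
      smul_eq_mul]
  have hyj : y ⬝ᵥ j = (q + 1) ^ 2 * t := by
    rw [dotProduct_comm, hy, hA, dotProduct_adjMatrix_mulVec_comm, ← hA, hAj, smul_dotProduct, hif,
      smul_eq_mul]
    ring
  have hxy : x ⬝ᵥ y = f ⬝ᵥ f := by
    rw [hy, hA, dotProduct_adjMatrix_mulVec_comm]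
  have hyy : y ⬝ᵥ y = 2 * q * (f ⬝ᵥ f) + (q + 1) * t ^ 2 := by
    conv_lhs => enter [1]; rw [hy]
    rw [hA, ← dotProduct_adjMatrix_mulVec_comm, ← hA, hAy, dotProduct_add, dotProduct_smul,
      dotProduct_smul, dotProduct_comm f i, hif, smul_eq_mul, smul_eq_mul]
    ring
  have hff : f ⬝ᵥ f = ∑ v, (#(G.neighborFinset v ∩ T) : ℤ) ^ 2 := by
    refine sum_congr rfl fun v _ => ?_
    rw [hf, hA, hx, adjMatrix_mulVec_indicator, pow_two]
  rw [← hff]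
  -- On functions supported on lines, `A^2` has eigenvalues `(q + 1)^2` (on `j`), `2q` and `0`. The
  -- vector `z` is `-2q(q + 1)` times the projection of `x` to the kernel, so `z ⬝ᵥ z ≥ 0` is
  -- exactly the claimed inequality.
  set z : V → ℤ := ((q : ℤ) + 1) • (y - (2 * (q : ℤ)) • x) - t • j with hz
  have hzz : 0 ≤ z ⬝ᵥ z := sum_nonneg fun v _ => mul_self_nonneg _
  have hexp : z ⬝ᵥ z = (2 * q * (q + 1)) *
      (2 * q * (q + 1) * t + t ^ 2 - (q + 1) * (f ⬝ᵥ f)) := by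
    simp only [hz, sub_dotProduct, dotProduct_sub, smul_dotProduct, dotProduct_smul, smul_eq_mul,
      dotProduct_comm y x, dotProduct_comm j y, dotProduct_comm j x, hxx, hxj, hjj, hyj, hxy, hyy]
    ring
  rw [hexp] at hzz
  have := nonneg_of_mul_nonneg_right hzz (by positivity)
  linarith

/-- Cauchy–Schwarz over `W` combined with the second moment bound. -/
theorem mul_sq_le_of_le_sum (h : G.IsQuadrangle q P) (hq : 0 < q) {T : Finset V} (hT : T ⊆ Pᶜ)
    (hT0 : 0 < #T) (W : Finset V) {m : ℕ}
    (hm : m * #T ≤ ∑ w ∈ W, #(G.neighborFinset w ∩ T)) :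
    (q + 1) * m ^ 2 * #T ≤ #W * (2 * q * (q + 1) + #T) := by
  have h1 := h.sum_sq_card_neighborFinset_inter_le hq hT
  have h2 : (∑ w ∈ W, #(G.neighborFinset w ∩ T)) ^ 2 ≤
      #W * ∑ w ∈ W, #(G.neighborFinset w ∩ T) ^ 2 := sq_sum_le_card_mul_sum_sq
  have h3 : ∑ w ∈ W, #(G.neighborFinset w ∩ T) ^ 2 ≤ ∑ w, #(G.neighborFinset w ∩ T) ^ 2 :=
    sum_le_univ_sum_of_nonneg fun _ => Nat.zero_le _
  have h1 : (q + 1) * ∑ v, #(G.neighborFinset v ∩ T) ^ 2 ≤ 2 * q * (q + 1) * #T + #T ^ 2 := by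
    exact_mod_cast h1
  refine Nat.le_of_mul_le_mul_right ?_ hT0
  calc (q + 1) * m ^ 2 * #T * #T = (q + 1) * (m * #T) ^ 2 := by ring
    _ ≤ (q + 1) * (#W * ∑ w, #(G.neighborFinset w ∩ T) ^ 2) := by
        gcongr
        exact (Nat.pow_le_pow_left hm 2).trans (h2.trans (by gcongr))
    _ = #W * ((q + 1) * ∑ w, #(G.neighborFinset w ∩ T) ^ 2) := by ring
    _ ≤ #W * (2 * q * (q + 1) * #T + #T ^ 2) := by gcongr
    _ = #W * (2 * q * (q + 1) + #T) * #T := by ring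

theorem card_le_of_disjoint_neighbors (h : G.IsQuadrangle q P) {X : Finset V} (hX : X ⊆ P)
    (hd : ∀ u ∈ X, ∀ v ∈ X, u ≠ v → ∀ w, G.Adj u w → ¬ G.Adj v w) : #X ≤ q ^ 2 + 1 := by
  have h1 : #(X.biUnion fun u => G.neighborFinset u) = #X * (q + 1) := by
    rw [card_biUnion, sum_congr rfl fun u _ => (card_neighborFinset_eq_degree ..).trans
      (h.regular u), sum_const, smul_eq_mul]
    intro u hu v hv huv
    refine Finset.disjoint_left.2 fun w hw hw' => ?_
    exact hd u hu v hv huv w ((mem_neighborFinset ..).1 hw) ((mem_neighborFinset ..).1 hw')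
  have h2 : (X.biUnion fun u => G.neighborFinset u) ⊆ Pᶜ := by
    intro w hw
    obtain ⟨u, hu, huw⟩ := mem_biUnion.1 hw
    exact mem_compl.2 ((h.mem_iff ((mem_neighborFinset ..).1 huw)).1 (hX hu))
  have h3 := card_le_card h2
  rw [h1, h.card_compl, mul_comm] at h3
  exact Nat.le_of_mul_le_mul_left h3 (by omega)

theorem sum_card_neighborFinset_inter_comm (S T : Finset V) :
    ∑ s ∈ S, #(G.neighborFinset s ∩ T) = ∑ t ∈ T, #(G.neighborFinset t ∩ S) := by
  have h := sum_card_bipartiteAbove_eq_sum_card_bipartiteBelow (s := S) (t := T) G.Adj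
  convert h using 3 with s _ t _
  · ext; simp [and_comm]
  · ext; simp [and_comm, adj_comm]

/-- Every neighbor of a line in `T` lies in `S`, and at most one lies in `X`. So `S` and `S \ X`
receive at least `q + 1` and `q` incidences per line of `T`, and the spectral bound prevents them
from being too small. -/
theorem card_add_card_le_of_card_le (h : G.IsQuadrangle q P) (hq : 3 ≤ q) (hodd : Odd q)
    {A B : Finset V} (hA : ∀ u ∈ A, ∀ v ∈ A, ¬ G.Adj u v)
    (hB : ∀ u ∈ B, ∀ v ∈ B, u ≠ v → ∀ w, G.Adj u w → ¬ G.Adj v w) (hAB : Disjoint A B)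
    (hle : #(A ∩ Pᶜ) ≤ #(A ∩ P)) : #A + #B ≤ (q + 1) * (q ^ 2 + 1) + (q ^ 2 + 1) := by
  set T := A ∩ Pᶜ with hT
  set X := B ∩ P with hX
  set S := P \ A with hS
  have hXS : X ⊆ S := fun v hv => by
    rw [hX, mem_inter] at hv
    exact mem_sdiff.2 ⟨hv.2, disjoint_right.1 hAB hv.1⟩
  have cX : #X ≤ q ^ 2 + 1 := h.card_le_of_disjoint_neighbors inter_subset_right
    fun u hu v hv => hB u (mem_inter.1 hu).1 v (mem_inter.1 hv).1
  have cY : #(B ∩ Pᶜ) ≤ q ^ 2 + 1 := h.compl.card_le_of_disjoint_neighbors inter_subset_right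
    fun u hu v hv => hB u (mem_inter.1 hu).1 v (mem_inter.1 hv).1
  have cA : #(A ∩ P) + #T = #A := by
    rw [hT, ← sdiff_eq_inter_compl]
    exact card_inter_add_card_sdiff A P
  have cB : #X + #(B ∩ Pᶜ) = #B := by
    rw [hX, ← sdiff_eq_inter_compl]
    exact card_inter_add_card_sdiff B P
  have cS : #(A ∩ P) + #S = (q + 1) * (q ^ 2 + 1) := by
    rw [hS, ← h.card, inter_comm]
    exact card_inter_add_card_sdiff P A
  have cW : #(S \ X) + #X = #S := card_sdiff_add_card_eq_card hXS
  suffices #T ≤ #(S \ X) by omega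
  rcases Nat.eq_zero_or_pos #T with hT0 | hT0
  · omega
  have eS : ∑ s ∈ S, #(G.neighborFinset s ∩ T) = (q + 1) * #T := by
    rw [sum_card_neighborFinset_inter_comm, mul_comm, ← smul_eq_mul, ← sum_const]
    refine sum_congr rfl fun t ht => ?_
    rw [inter_eq_left.2, card_neighborFinset_eq_degree, h.regular t]
    intro s hs
    rw [mem_neighborFinset] at hs
    rw [hT, mem_inter, mem_compl] at ht
    have := h.mem_iff hs
    exact mem_sdiff.2 ⟨by tauto, fun hsA => hA t ht.1 s hsA hs⟩
  have eX : ∑ s ∈ X, #(G.neighborFinset s ∩ T) ≤ #T := by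
    rw [sum_card_neighborFinset_inter_comm, card_eq_sum_ones T]
    refine sum_le_sum fun t _ => card_le_one.2 fun u hu v hv => ?_
    rw [mem_inter, mem_neighborFinset] at hu hv
    by_contra huv
    exact hB u (mem_inter.1 hu.2).1 v (mem_inter.1 hv.2).1 huv t hu.1.symm hv.1.symm
  have eW : q * #T ≤ ∑ s ∈ S \ X, #(G.neighborFinset s ∩ T) := by
    have := sum_sdiff hXS (f := fun s => #(G.neighborFinset s ∩ T))
    rw [eS, add_mul] at this
    omega
  have hTP : T ⊆ Pᶜ := inter_subset_right
  have b1 := h.mul_sq_le_of_le_sum (by omega) hTP hT0 S eS.ge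
  have b2 := h.mul_sq_le_of_le_sum (by omega) hTP hT0 (S \ X) eW
  generalize #T = t at *
  generalize #(S \ X) = w at *
  generalize #S = s at *
  generalize #(A ∩ P) = r at *
  by_contra! hlt
  have b3 : (q + 1) * q ^ 2 < 2 * q * (q + 1) + t := by
    by_contra! hc
    have : w * (2 * q * (q + 1) + t) < t * ((q + 1) * q ^ 2) :=
      (Nat.mul_le_mul_left w hc).trans_lt ((Nat.mul_lt_mul_right (by positivity)).2 hlt)
    linarith
  -- Here `t ≤ r` gives `t ≤ (q + 1)(q^2 + 1) = (q + 1)^3 - 2q(q + 1)`, which is what `hc'` needs.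
  have b4 : t ≤ s := by
    by_contra! hc
    have hc' : 2 * q * (q + 1) + t ≤ (q + 1) * (q + 1) ^ 2 := by nlinarith
    have : s * (2 * q * (q + 1) + t) < t * ((q + 1) * (q + 1) ^ 2) :=
      (Nat.mul_le_mul_left s hc').trans_lt ((Nat.mul_lt_mul_right (by positivity)).2 hc)
    linarith
  have b5 : 2 * t ≤ (q + 1) * (q ^ 2 + 1) := by omega
  obtain ⟨m, hm⟩ := hodd
  -- `b3` and `b5` give `2q(q - 2) < q^2 + 1`, false for `q ≥ 5`. For `q = 3` they leave `13 ≤ t ≤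
  -- 20`; then `#X ≤ 10` and `w < t` give `s ≤ t + 9`, and `b1` becomes `64t ≤ (t + 9)(t + 24)`,
  -- which fails on this range.
  rcases (show q = 3 ∨ 5 ≤ q by omega) with rfl | h5
  · norm_num at *
    have hs : s ≤ t + 9 := by omega
    have := b1.trans (Nat.mul_le_mul_right _ hs)
    have l1 : 13 ≤ t := by omega
    have l2 : t ≤ 20 := by omega
    clear * - this l1 l2
    interval_cases t <;> omega
  · nlinarith

theorem card_add_card_le (h : G.IsQuadrangle q P) (hq : 3 ≤ q) (hodd : Odd q)
    {A B : Finset V} (hA : ∀ u ∈ A, ∀ v ∈ A, ¬ G.Adj u v)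
    (hB : ∀ u ∈ B, ∀ v ∈ B, u ≠ v → ∀ w, G.Adj u w → ¬ G.Adj v w) (hAB : Disjoint A B) :
    #A + #B ≤ (q + 1) * (q ^ 2 + 1) + (q ^ 2 + 1) := by
  rcases le_total #(A ∩ Pᶜ) #(A ∩ P) with hle | hle
  · exact h.card_add_card_le_of_card_le hq hodd hA hB hAB hle
  · exact h.compl.card_add_card_le_of_card_le hq hodd hA hB hAB (by rwa [compl_compl])

/-! ### Distances in the quadrangle and the lower bound. -/

theorem exists_walk_three (h : G.IsQuadrangle q P) {u v : V} (huv : ¬ (u ∈ P ↔ v ∈ P)) :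
    ∃ p : G.Walk u v, p.length = 3 := by
  have h1 := h.pow_three u v
  rw [adjMatrix_pow_three_apply, if_neg huv, adjMatrix_apply] at h1
  have h2 : (G.threeWalks u v).Nonempty := by
    rw [nonempty_iff_ne_empty]
    rintro h0
    rw [h0, card_empty] at h1
    split_ifs at h1 <;> push_cast at h1 <;> omega
  obtain ⟨⟨a, b⟩, hab⟩ := h2
  obtain ⟨h₁, h₂, h₃⟩ := mem_threeWalks.1 hab
  exact ⟨.cons h₁ (.cons h₂ (.cons h₃ .nil)), rfl⟩

theorem edist_le_four (h : G.IsQuadrangle q P) (u v : V) : G.edist u v ≤ 4 := by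
  by_cases huv : u ∈ P ↔ v ∈ P
  · obtain ⟨a, ha⟩ : ∃ a, G.Adj u a := by
      rw [← degree_pos_iff_exists_adj, h.regular u]
      omega
    obtain ⟨p, hp⟩ := h.exists_walk_three (u := a) (v := v) (by have := h.mem_iff ha; tauto)
    exact (edist_le (.cons ha p)).trans (by rw [Walk.length_cons, hp]; rfl)
  · obtain ⟨p, hp⟩ := h.exists_walk_three huv
    exact (edist_le p).trans (by rw [hp]; norm_num)

theorem le_of_isPackingColoring (h : G.IsQuadrangle q P) (hq : 3 ≤ q) (hodd : Odd q) {k : ℕ}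
    {Γ : V → ℕ} (hΓ : IsPackingColoring G k Γ) : (q ^ 2 + 1) * (q - 1) + 3 ≤ k := by
  obtain ⟨hbd, hpack⟩ := hΓ
  have hcn {i : ℕ} (hi : 2 ≤ i) (u v : V) (hu : Γ u = i) (hv : Γ v = i) (huv : u ≠ v) (w : V)
      (huw : G.Adj u w) : ¬ G.Adj v w := fun hvw => by
    have h1 := hpack u v huv (hu.trans hv.symm)
    have h2 := edist_le (.cons huw (.cons hvw.symm .nil) : G.Walk u v)
    have h3 := h1.trans h2
    simp only [Walk.length_cons, Walk.length_nil, Nat.cast_le] at h3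
    omega
  have h12 : #{v | Γ v = 1} + #{v | Γ v = 2} ≤ (q + 1) * (q ^ 2 + 1) + (q ^ 2 + 1) := by
    refine h.card_add_card_le hq hodd (fun u hu v hv huv => ?_) (fun u hu v hv => ?_)
      (disjoint_filter.2 fun v _ hv => by omega)
    · rw [mem_filter_univ] at hu hv
      have h1 := hpack u v huv.ne (hu.trans hv.symm)
      rw [edist_eq_one_iff_adj.2 huv, hu] at h1
      norm_num at h1
    · rw [mem_filter_univ] at hu hv
      exact hcn le_rfl u v hu hv
  have h3 : #{v | Γ v = 3} ≤ q ^ 2 + 1 := by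
    have hsame : ∀ u v, Γ u = 3 → Γ v = 3 → (u ∈ P ↔ v ∈ P) := fun u v hu hv => by
      by_contra huv
      have h1 := hpack u v (by rintro rfl; exact huv Iff.rfl) (hu.trans hv.symm)
      obtain ⟨p, hp⟩ := h.exists_walk_three huv
      have h2 := h1.trans (edist_le p)
      rw [hp, hu, Nat.cast_le] at h2
      omega
    have hd : ∀ u ∈ ({v | Γ v = 3} : Finset V), ∀ v ∈ ({v | Γ v = 3} : Finset V), u ≠ v →
        ∀ w, G.Adj u w → ¬ G.Adj v w := fun u hu v hv => by
      rw [mem_filter_univ] at hu hv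
      exact hcn (by omega) u v hu hv
    rcases ({v | Γ v = 3} : Finset V).eq_empty_or_nonempty with h0 | ⟨v₀, hv₀⟩
    · simp [h0]
    · rw [mem_filter_univ] at hv₀
      by_cases hP : v₀ ∈ P
      · exact h.card_le_of_disjoint_neighbors
          (fun v hv => (hsame _ _ hv₀ (mem_filter.1 hv).2).1 hP) hd
      · exact h.compl.card_le_of_disjoint_neighbors (fun v hv => mem_compl.2 fun hv' =>
          hP ((hsame _ _ hv₀ (mem_filter.1 hv).2).2 hv')) hd
  have h4 : #{v | 4 ≤ Γ v} ≤ k - 3 := by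
    have : #{v | 4 ≤ Γ v} ≤ #(Icc 4 k) := by
      refine card_le_card_of_injOn Γ (fun v hv => ?_) (fun u hu v hv huv => ?_)
      · exact mem_coe.2 (mem_Icc.2 ⟨(mem_filter.1 hv).2, (hbd v).2⟩)
      · by_contra hne
        have h1 := (hpack u v hne huv).trans (h.edist_le_four u v)
        have h2 : Γ u + 1 ≤ 4 := by exact_mod_cast h1
        have h3 : 4 ≤ Γ u := (mem_filter.1 hu).2
        omega
    simpa using this
  have hV : Fintype.card V = 2 * ((q + 1) * (q ^ 2 + 1)) := by
    rw [← card_add_card_compl P, h.card, h.card_compl]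
    ring
  have hsum : Fintype.card V ≤ #{v | Γ v = 1} + #{v | Γ v = 2} + #{v | Γ v = 3} +
      #{v | 4 ≤ Γ v} := by
    have hun : (univ : Finset V) = ((univ.filter fun v => Γ v = 1) ∪
        (univ.filter fun v => Γ v = 2) ∪ (univ.filter fun v => Γ v = 3)) ∪
        (univ.filter fun v => 4 ≤ Γ v) := by
      ext v
      simp only [mem_union, mem_filter, mem_univ, true_and, true_iff]
      have := (hbd v).1
      omega
    have hc := congrArg Finset.card hun
    rw [card_univ] at hc
    rw [hc]
    exact (card_union_le _ _).trans (Nat.add_le_add_right ((card_union_le _ _).trans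
      (Nat.add_le_add_right (card_union_le _ _) _)) _)
  obtain ⟨n, rfl⟩ : ∃ n, q = n + 1 := ⟨q - 1, by omega⟩
  rw [Nat.add_sub_cancel]
  -- Positivity excludes `k < 3`, where the subtraction in `h4` truncates.
  have : 0 < ((n + 1) ^ 2 + 1) * n := Nat.mul_pos (by positivity) (by omega)
  have e : 2 * ((n + 1 + 1) * ((n + 1) ^ 2 + 1)) = ((n + 1) ^ 2 + 1) * n +
    ((n + 1 + 1) * ((n + 1) ^ 2 + 1) + ((n + 1) ^ 2 + 1)) + ((n + 1) ^ 2 + 1) := by ring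
  omega

end IsQuadrangle

end SimpleGraph

/-! ### Packing colorings from three classes. -/

namespace SimpleGraph

variable {V W : Type*} {G : SimpleGraph V} {H : SimpleGraph W}

theorem Iso.edist_le (φ : G ≃g H) (u v : V) : H.edist (φ u) (φ v) ≤ G.edist u v :=
  le_iInf fun p => (SimpleGraph.edist_le (p.map φ.toHom)).trans_eq (by rw [Walk.length_map])

/-- Class `0` holds the vertices still uncolored; they receive the distinct colors from 4 on. -/
theorem exists_isPackingColoring_of_three_classes (c : V → ℕ) (hc : ∀ v, c v ≤ 3)
    (hpack : ∀ u v, u ≠ v → c u = c v → c u ≠ 0 → ((c u + 1 : ℕ) : ℕ∞) ≤ G.edist u v)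
    [Finite {v // c v = 0}] :
    ∃ Γ : V → ℕ, IsPackingColoring G (Nat.card {v // c v = 0} + 3) Γ := by
  set e := Finite.equivFin {v // c v = 0} with he
  refine ⟨fun v => if h : c v = 0 then e ⟨v, h⟩ + 4 else c v, fun v => ?_, fun u v huv h => ?_⟩
  · dsimp only
    split_ifs with h
    · have := (e ⟨v, h⟩).isLt
      omega
    · have := hc v
      omega
  · dsimp only at h ⊢
    split_ifs at h with h1 h2 h2
    · exact absurd (congrArg Subtype.val (e.injective (Fin.ext (Nat.add_right_cancel h)))) huv
    · have := hc v
      omega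
    · have := hc u
      omega
    · rw [dif_neg h1]
      exact hpack u v huv h h1

end SimpleGraph

/-! ### Ovoids in coordinates and the upper bound. -/

namespace GQCoord

variable {F : Type*} [Field F]

theorem not_adj_inl_inl (x y : GQCoord F) : ¬ (gqGraph F).Adj (.inl x) (.inl y) := id

theorem not_adj_inr_inr (x y : GQCoord F) : ¬ (gqGraph F).Adj (.inr x) (.inr y) := id

theorem four_le_edist_inl {x y : GQCoord F} (hne : x ≠ y)
    (h : ∀ l, GQIncident x l → ¬ GQIncident y l) :
    4 ≤ (gqGraph F).edist (.inl x) (.inl y) := by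
  refine le_iInf fun p => ?_
  suffices 4 ≤ p.length by exact_mod_cast this
  match p with
  | .nil => exact absurd rfl hne
  | .cons h₁ .nil => exact (not_adj_inl_inl _ _ h₁).elim
  | .cons (v := .inl _) h₁ (.cons _ .nil) => exact (not_adj_inl_inl _ _ h₁).elim
  | .cons (v := .inr l) h₁ (.cons h₂ .nil) => exact (h l h₁ h₂).elim
  | .cons (v := .inl _) h₁ (.cons _ (.cons _ .nil)) => exact (not_adj_inl_inl _ _ h₁).elim
  | .cons (v := .inr _) _ (.cons (v := .inl _) _ (.cons h₃ .nil)) =>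
    exact (not_adj_inl_inl _ _ h₃).elim
  | .cons (v := .inr _) _ (.cons (v := .inr _) h₂ (.cons _ .nil)) =>
    exact (not_adj_inr_inr _ _ h₂).elim
  | .cons _ (.cons _ (.cons _ (.cons _ _))) => simp only [SimpleGraph.Walk.length_cons]; omega

theorem two_le_edist_inr {x y : GQCoord F} (hne : x ≠ y) :
    2 ≤ (gqGraph F).edist (.inr x) (.inr y) := by
  refine le_iInf fun p => ?_
  suffices 2 ≤ p.length by exact_mod_cast this
  match p with
  | .nil => exact absurd rfl hne
  | .cons h₁ .nil => exact (not_adj_inr_inr _ _ h₁).elim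
  | .cons _ (.cons _ _) => simp only [SimpleGraph.Walk.length_cons]; omega

/-- The points `(x, y, ν x + d)`, with `(ρ, ρ, ρ)`, form an ovoid when `ν` is not a square. -/
theorem eq_of_gqIncident {ν : F} (hν : ¬ IsSquare ν) {d x y x' y' : F} {l : GQCoord F}
    (h : GQIncident (.aff x y (ν * x + d)) l) (h' : GQIncident (.aff x' y' (ν * x' + d)) l) :
    x = x' ∧ y = y' := by
  cases l with
  | aff a b c =>
    obtain ⟨h1, h2⟩ := h
    obtain ⟨h1', h2'⟩ := h'
    -- Along an affine line the third coordinate has slope `a ^ 2` in `x`, on the ovoid it has slope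
    -- `ν`.
    have h3 : (ν - a ^ 2) * (x - x') = 0 := by linear_combination h2 - h2'
    have h4 : x = x' := by
      rcases mul_eq_zero.1 h3 with h4 | h4
      · exact absurd ⟨a, by linear_combination h4⟩ hν
      · exact sub_eq_zero.1 h4
    exact ⟨h4, by rw [h1, h1', h4]⟩
  | rho₁ b c =>
    obtain ⟨rfl, rfl⟩ := h
    exact ⟨h'.1.symm, h'.2.symm⟩
  | rho₂ c => exact h.elim
  | rho₃ => exact h.elim

theorem not_gqIncident_rho₃ {x y z : F} {l : GQCoord F} (h : GQIncident (.aff x y z) l) :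
    ¬ GQIncident .rho₃ l := by
  cases l <;> first | exact id | exact h.elim

open Classical in
/-- The lines have class `1`, an ovoid has class `2`, a second ovoid without its common point
with the first one has class `3`, and the remaining points have class `0`. -/
noncomputable def ovoidClass (ν : F) : GQCoord F ⊕ GQCoord F → ℕ
  | .inr _ => 1
  | .inl (.aff x _ z) => if z = ν * x then 2 else if z = ν * x + 1 then 3 else 0
  | .inl (.rho₁ _ _) => 0
  | .inl (.rho₂ _) => 0
  | .inl .rho₃ => 2

theorem ovoidClass_le (ν : F) (v : GQCoord F ⊕ GQCoord F) : ovoidClass ν v ≤ 3 := by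
  unfold ovoidClass
  split <;> (try split_ifs) <;> omega

theorem ovoidClass_inl_eq_two {ν : F} {p : GQCoord F} (h : ovoidClass ν (.inl p) = 2) :
    p = .rho₃ ∨ ∃ x y, p = .aff x y (ν * x + 0) := by
  cases p with
  | aff x y z =>
    simp only [ovoidClass] at h
    split_ifs at h with h1
    · exact .inr ⟨x, y, by rw [h1, add_zero]⟩
    all_goals omega
  | rho₃ => exact .inl rfl
  | _ => simp [ovoidClass] at h

theorem ovoidClass_inl_eq_three {ν : F} {p : GQCoord F} (h : ovoidClass ν (.inl p) = 3) :
    ∃ x y, p = .aff x y (ν * x + 1) := by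
  cases p with
  | aff x y z =>
    simp only [ovoidClass] at h
    split_ifs at h with h1 h2
    · omega
    · exact ⟨x, y, by rw [h2]⟩
  | _ => simp [ovoidClass] at h

theorem ovoidClass_inl_ne_one (ν : F) (p : GQCoord F) : ovoidClass ν (.inl p) ≠ 1 := by
  unfold ovoidClass
  split <;> (try split_ifs) <;> simp_all

theorem ovoidClass_le_edist {ν : F} (hν : ¬ IsSquare ν) (u v : GQCoord F ⊕ GQCoord F)
    (huv : u ≠ v) (h : ovoidClass ν u = ovoidClass ν v) (h0 : ovoidClass ν u ≠ 0) :
    ((ovoidClass ν u + 1 : ℕ) : ℕ∞) ≤ (gqGraph F).edist u v := by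
  rcases u with p | l <;> rcases v with p' | l'
  · have hne : p ≠ p' := fun e => huv (by rw [e])
    refine (?_ : _ ≤ (4 : ℕ∞)).trans (four_le_edist_inl hne fun l hp hp' => ?_)
    · have := ovoidClass_le ν (.inl p)
      exact_mod_cast Nat.succ_le_succ this
    have h23 : ovoidClass ν (.inl p) = 2 ∨ ovoidClass ν (.inl p) = 3 := by
      have := ovoidClass_le ν (.inl p)
      have := ovoidClass_inl_ne_one ν p
      omega
    rcases h23 with h2 | h3
    · rcases ovoidClass_inl_eq_two h2 with rfl | ⟨x, y, rfl⟩ <;>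
        rcases ovoidClass_inl_eq_two (h.symm.trans h2) with rfl | ⟨x', y', rfl⟩
      · exact hne rfl
      · exact not_gqIncident_rho₃ hp' hp
      · exact not_gqIncident_rho₃ hp hp'
      · obtain ⟨rfl, rfl⟩ := eq_of_gqIncident hν hp hp'
        exact hne rfl
    · obtain ⟨x, y, rfl⟩ := ovoidClass_inl_eq_three h3
      obtain ⟨x', y', rfl⟩ := ovoidClass_inl_eq_three (h.symm.trans h3)
      obtain ⟨rfl, rfl⟩ := eq_of_gqIncident hν hp hp'
      exact hne rfl
  · exact absurd h (ovoidClass_inl_ne_one ν p)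
  · exact absurd h.symm (ovoidClass_inl_ne_one ν p')
  · exact two_le_edist_inr fun e => huv (by rw [e])

theorem exists_surjective_ovoidClass_eq_zero (ν : F) :
    ∃ g : (F × F × {d : F // d ≠ 0 ∧ d ≠ 1}) ⊕ (F × F) ⊕ F → {v // ovoidClass ν v = 0},
      g.Surjective := by
  refine ⟨Sum.elim (fun a => ⟨.inl (.aff a.1 a.2.1 (ν * a.1 + a.2.2)), ?_⟩)
    (Sum.elim (fun a => ⟨.inl (.rho₁ a.1 a.2), rfl⟩) fun a => ⟨.inl (.rho₂ a), rfl⟩), ?_⟩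
  · simp [ovoidClass, a.2.2.2.1, a.2.2.2.2]
  · rintro ⟨(p | l), h⟩
    · cases p with
      | aff x y z =>
        refine ⟨.inl ⟨x, y, z - ν * x, ?_, ?_⟩, by simp⟩
        · rintro e
          simp [ovoidClass, sub_eq_zero.1 e] at h
        · rintro e
          simp [ovoidClass, sub_eq_iff_eq_add'.1 e] at h
      | rho₁ b c => exact ⟨.inr (.inl (b, c)), rfl⟩
      | rho₂ c => exact ⟨.inr (.inr c), rfl⟩
      | rho₃ => simp [ovoidClass] at h
    · simp [ovoidClass] at h

theorem exists_isPackingColoring [Finite F] (hodd : Odd (Nat.card F)) :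
    ∃ Γ : GQCoord F ⊕ GQCoord F → ℕ, ∃ k ≤ (Nat.card F ^ 2 + 1) * (Nat.card F - 1) + 4,
      IsPackingColoring (gqGraph F) k Γ := by
  classical
  have := Fintype.ofFinite F
  rw [Nat.card_eq_fintype_card] at hodd ⊢
  obtain ⟨ν, hν⟩ := FiniteField.exists_nonsquare (F := F) fun h2 => by
    have := FiniteField.even_card_of_char_two h2
    rw [Nat.odd_iff] at hodd
    omega
  obtain ⟨g, hg⟩ := exists_surjective_ovoidClass_eq_zero ν
  have : Finite {v // ovoidClass ν v = 0} := Finite.of_surjective g hg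
  obtain ⟨Γ, hΓ⟩ := SimpleGraph.exists_isPackingColoring_of_three_classes (ovoidClass ν)
    (ovoidClass_le ν) (ovoidClass_le_edist hν)
  refine ⟨Γ, _, ?_, hΓ⟩
  have hcard := Nat.card_le_card_of_surjective g hg
  have hd : Fintype.card {d : F // d ≠ 0 ∧ d ≠ 1} = Fintype.card F - 2 := by
    rw [Fintype.card_subtype, ← card_pair (zero_ne_one (α := F)), ← card_compl]
    congr 1
    ext; simp
  rw [Nat.card_eq_fintype_card (α := _ ⊕ _), Fintype.card_sum, Fintype.card_sum, Fintype.card_prod,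
    Fintype.card_prod, Fintype.card_prod, hd] at hcard
  obtain ⟨n, hn⟩ : ∃ n, Fintype.card F = n + 2 := ⟨Fintype.card F - 2, by
    have := Fintype.one_lt_card (α := F)
    omega⟩
  rw [hn] at hcard ⊢
  -- With `q = n + 2`, class `0` has at most `q^2(q - 2) + q^2 + q = (q^2 + 1)(q - 1) + 1` points.
  refine (Nat.add_le_add_right hcard 3).trans_eq ?_
  simp only [Nat.add_sub_cancel, show n + 2 - 1 = n + 1 by omega]
  ring

end GQCoord

theorem mainTheorem2 (q : ℕ) (hq : IsPrimePow q) (hodd : Odd q)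
    {V : Type*} [Fintype V] (G : SimpleGraph V) [DecidableRel G.Adj]
    (hG : IsMooreGraph G (q + 1) 8) :
    (q ^ 2 + 1) * (q - 1) + 3 ≤ packingChromaticNumber G ∧
      ∀ (F : Type*) [Field F] [Fintype F], Fintype.card F = q →
        Nonempty (G ≃g gqGraph F) →
          packingChromaticNumber G ≤ (q ^ 2 + 1) * (q - 1) + 4 := by
  classical
  refine ⟨?_, fun F _ _ hF ⟨φ⟩ => ?_⟩
  · obtain ⟨P, hP⟩ := SimpleGraph.exists_isQuadrangle q hG
    obtain ⟨Γ, hΓ⟩ := exists_isPackingColoring_packingChromaticNumber G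
    have hq3 : 3 ≤ q := by
      have := hq.one_lt
      rcases hodd with ⟨m, rfl⟩
      omega
    exact hP.le_of_isPackingColoring hq3 hodd hΓ
  · rw [← Nat.card_eq_fintype_card] at hF
    subst hF
    obtain ⟨Γ, k, hk, hΓ⟩ := GQCoord.exists_isPackingColoring (F := F) hodd
    have hΓφ : IsPackingColoring G k (Γ ∘ φ) := by
      refine ⟨fun v => hΓ.1 (φ v), fun u v huv h => ?_⟩
      exact (hΓ.2 (φ u) (φ v) (fun e => huv (φ.injective e)) h).trans (φ.edist_le u v)
    have hk' : k ∈ {k : ℕ | ∃ Γ : V → ℕ, IsPackingColoring G k Γ} := ⟨_, hΓφ⟩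
    exact (Nat.sInf_le hk').trans hk
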